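/- Let $\Gamma=\{(\xi_1,\xi_2)\in\mathbb{R}^2:\xi_1+\xi_2=0\}$. There exists a function $m:\mathbb{R}^2\to\mathbb{C}$, smooth on $\mathbb{R}^2\setminus\Gamma$, such that for every multi-index $\vec\alpha\in\mathbb{N}^2$ there is a constant $C_{\vec\alpha}$ with $$\left|\partial^{\vec\alpha}m(\vec\xi)\right|\le \frac{C_{\vec\alpha}}{\operatorname{dist}(\vec\xi,\Gamma)^{|\vec\alpha|}}\qquad\text{for all }\vec\xi\in\mathbb{R}^2\setminus\Gamma,$$ and such that the bilinear operator $$T_m(f_1,f_2)(x)=\int_{\mathbb{R}^2}m(\xi_1,\xi_2)\,\hat f_1(\xi_1)\,\hat f_2(\xi_2)\,e^{2\pi i x(\xi_1+\xi_2)}\,d\xi_1\,d\xi_2,\qquad f_1,f_2\in\mathcal{S}(\mathbb{R}),$$ where $\hat f(\xi)=\int_{\mathbb R} f(x)e^{-2\pi i x\xi}\,dx$, satisfies no $L^p$ estimates: for all $0<p_1,p_2\le\infty$ and $p$ given by $\frac1p=\frac1{p_1}+\frac1{p_2}$ (with $1/\infty=0$), there is no finite constant $C$ such that $$\|T_m(f_1,f_2)\|_{L^p(\mathbb{R})}\le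 C\,\|f_1\|_{L^{p_1}(\mathbb{R})}\,\|f_2\|_{L^{p_2}(\mathbb{R})}\qquad\text{for all }f_1,f_2\in\mathcal{S}(\mathbb{R}).$$ -/

import Mathlib

open MeasureTheory
open scoped FourierTransform SchwartzMap ContDiff ENNReal NNReal

/-- The frequency plane `ℝ²` with its Euclidean norm. -/
abbrev FreqPlane : Type := EuclideanSpace ℝ (Fin 2)

/-- The singular line `Γ = {ξ₁ + ξ₂ = 0}`. -/
def singularLine : Set FreqPlane := {ξ | ξ 0 + ξ 1 = 0}

/-- The partial derivative `∂ᵢ m` of a function on the plane. -/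
noncomputable def partialDeriv (i : Fin 2) (m : FreqPlane → ℂ) : FreqPlane → ℂ :=
  fun ξ => lineDeriv ℝ m ξ (EuclideanSpace.single i 1)

/-- The mixed partial derivative `∂^α m = ∂₁^{α₁} ∂₂^{α₂} m` for a multi-index `α`. -/
noncomputable def multiDeriv (α : Fin 2 → ℕ) (m : FreqPlane → ℂ) : FreqPlane → ℂ :=
  (partialDeriv 0)^[α 0] ((partialDeriv 1)^[α 1] m)

/-- `m` is adapted to the line `Γ` in the Mikhlin–Hörmander sense: it is smooth off `Γ`, and for
every multi-index `α` there is a constant `C_α` with `|∂^α m(ξ)| ≤ C_α dist(ξ, Γ)^{-|α|}` off `Γ`.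
(In particular, with `α = 0`, `m` is bounded off the null set `Γ`.) -/
def IsAdaptedToLine (m : FreqPlane → ℂ) : Prop :=
  ContDiffOn ℝ ∞ m singularLineᶜ ∧
    ∀ α : Fin 2 → ℕ, ∃ C : ℝ, ∀ ξ ∈ singularLineᶜ,
      ‖multiDeriv α m ξ‖ ≤ C / Metric.infDist ξ singularLine ^ (α 0 + α 1)

/-- The bilinear multiplier operator
`T_m(f₁, f₂)(x) = ∫_{ℝ²} m(ξ₁, ξ₂) f̂₁(ξ₁) f̂₂(ξ₂) e^{2πi x (ξ₁ + ξ₂)} dξ₁ dξ₂`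
on Schwartz functions, with `f̂(ξ) = ∫ f(x) e^{-2πi x ξ} dx`. -/
noncomputable def bilinearMultiplier (m : FreqPlane → ℂ) (f₁ f₂ : 𝓢(ℝ, ℂ)) : ℝ → ℂ :=
  fun x => ∫ ξ : FreqPlane, m ξ * 𝓕 (f₁ : ℝ → ℂ) (ξ 0) * 𝓕 (f₂ : ℝ → ℂ) (ξ 1) *
    Complex.exp (2 * Real.pi * Complex.I * x * (ξ 0 + ξ 1))

/-- The a priori estimate `‖T(f₁, f₂)‖_p ≤ C ‖f₁‖_{p₁} ‖f₂‖_{p₂}` for all Schwartz `f₁, f₂`, with a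
finite constant `C`. -/
def SatisfiesLpEstimate (T : 𝓢(ℝ, ℂ) → 𝓢(ℝ, ℂ) → ℝ → ℂ) (p₁ p₂ p : ℝ≥0∞) : Prop :=
  ∃ C : ℝ≥0, ∀ f₁ f₂ : 𝓢(ℝ, ℂ),
    eLpNorm (T f₁ f₂) p volume ≤ C * eLpNorm f₁ p₁ volume * eLpNorm f₂ p₂ volume

open Filter Topology

/-! ### The symbol -/

/-! Write e(t) = e^{2πit}, u = ξ₁ + ξ₂, v = ξ₁ - ξ₂, λ_k = 4^{k²}, r_k = 1/λ_k. The symbol is Σ_k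
g(r_k u) e(r_k v/4) with g = ψ̂ supported in [1/2, 3/2] and g(1) = 1. The packets have disjoint
supports, and each derivative costs a factor r_k ~ 1/|u|, so the symbol is adapted to Γ
(`isAdaptedToLine_lacSymbol`). The modulation in v shifts the two inputs apart: packet k averages
f₁(z + r_k/4) f₂(z - r_k/4) against ψ at scale r_k about x (`integral_waveTerm`).

The test functions are f₁ = χ e^{iΦ}, f₂ = χ e^{-iΦ}, where Φ = a Σ_{l<N} sin(2πλ_l y). For k < N,
the difference of Φ across the shift is nearly 2a cos(2πλ_k z): lower frequencies barely move, and
higher ones cancel exactly (`abs_lacPhase_diff_sub_le`). Expand its exponential to second order.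
Since ψ̂ sees only the harmonic +1 among 0, ±1, ±2, packet k returns i a e(λ_k x) with error O(a³ +
4^{-k}); the quadratic term leaves no trace (`integral_mul_expTaylor`). Hence on [0, 1] the output
is i a Σ_{k<N} e(λ_k x) + O(1) whenever N a³ ≤ 1 (`exists_norm_bilinearMultiplier_sub_le`).

By its second and fourth moments, the lacunary sum has size at least √(N/2) on a set of measure at
least 1/8 (`volume_lacLarge`). With a = 1/n and N = n³ the output is at least √(n/2) - O(1) there,
while |f₁| = |f₂| = χ does not depend on n. Only the size on a set of fixed measure is used, so
every exponent is covered. -/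

/-- The character `θ ↦ e^{2πiθ}` of the line. -/
noncomputable def unitExp (θ : ℝ) : ℂ := Complex.exp ((2 * Real.pi * θ : ℝ) * Complex.I)

lemma norm_unitExp (θ : ℝ) : ‖unitExp θ‖ = 1 := Complex.norm_exp_ofReal_mul_I _

lemma unitExp_add (a b : ℝ) : unitExp (a + b) = unitExp a * unitExp b := by
  simp only [unitExp, ← Complex.exp_add]
  congr 1
  push_cast
  ring

lemma unitExp_zero : unitExp 0 = 1 := by simp [unitExp]

lemma contDiff_unitExp : ContDiff ℝ ∞ unitExp := by
  have h : ContDiff ℝ ∞ (fun θ : ℝ => ((2 * Real.pi * θ : ℝ) : ℂ)) :=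
    Complex.ofRealCLM.contDiff.comp (contDiff_const.mul contDiff_id)
  exact (h.mul contDiff_const).cexp

lemma continuous_unitExp : Continuous unitExp := contDiff_unitExp.continuous

lemma hasDerivAt_unitExp (θ : ℝ) :
    HasDerivAt unitExp (2 * Real.pi * Complex.I * unitExp θ) θ := by
  have h : HasDerivAt (fun θ : ℝ => ((2 * Real.pi * θ : ℝ) : ℂ) * Complex.I)
      (((2 * Real.pi * 1 : ℝ) : ℂ) * Complex.I) θ :=
    (((hasDerivAt_id θ).const_mul (2 * Real.pi)).ofReal_comp).mul_const _
  refine h.cexp.congr_deriv ?_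
  rw [unitExp]
  push_cast
  ring

/-- The lacunary sequence of frequencies `4^{k²}`. -/
noncomputable def lac (k : ℕ) : ℝ := (4 : ℝ) ^ (k ^ 2)

lemma lac_pos (k : ℕ) : 0 < lac k := by unfold lac; positivity

lemma one_le_lac (k : ℕ) : 1 ≤ lac k := one_le_pow₀ (by norm_num)

/-- k² - j² = (k - j)(k + j) ≥ j + k. The quadratic exponent is chosen for this: the ratio λ_j/λ_k
is then summable over both indices, so interactions between scales cost O(1) in total. -/
lemma pow_add_mul_lac_le {j k : ℕ} (h : j < k) : (4 : ℝ) ^ (j + k) * lac j ≤ lac k := by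
  unfold lac
  rw [← pow_add]
  apply pow_le_pow_right₀ (by norm_num)
  nlinarith

lemma four_mul_lac_le {j k : ℕ} (h : j < k) : 4 * lac j ≤ lac k := by
  refine le_trans ?_ (pow_add_mul_lac_le h)
  gcongr
  · exact (lac_pos j).le
  · exact le_self_pow₀ (by norm_num) (by omega)

lemma four_pow_le_lac (k : ℕ) : (4 : ℝ) ^ k ≤ lac k := by
  unfold lac
  exact pow_le_pow_right₀ (by norm_num) (by nlinarith [Nat.zero_le k, Nat.le_self_pow two_ne_zero k])

lemma exists_lt_lac (u : ℝ) : ∃ k, u < lac (k + 1) / 2 := by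
  obtain ⟨n, hn⟩ := pow_unbounded_of_one_lt (2 * u) (by norm_num : (1 : ℝ) < 4)
  refine ⟨n, ?_⟩
  have h1 : (4 : ℝ) ^ n ≤ 4 ^ (n + 1) := pow_le_pow_right₀ (by norm_num) (by omega)
  have := four_pow_le_lac (n + 1)
  linarith

/-- A smooth profile supported in `[1/2, 3/2]`. -/
structure IsProfile (g : ℝ → ℂ) : Prop where
  contDiff : ContDiff ℝ ∞ g
  eq_zero : ∀ w, w ∉ Set.Icc (1 / 2 : ℝ) (3 / 2) → g w = 0

/-- The wave packet `g(r u) e^{2πi r v / 4}` in the coordinates `u = ξ₁ + ξ₂`, `v = ξ₁ - ξ₂`. -/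
noncomputable def waveTerm (g : ℝ → ℂ) (r : ℝ) (ξ : FreqPlane) : ℂ :=
  g (r * (ξ 0 + ξ 1)) * unitExp (r / 4 * (ξ 0 - ξ 1))

/-- The superposition of the wave packets of one profile over all lacunary scales. -/
noncomputable def lacSymbol (g : ℝ → ℂ) (ξ : FreqPlane) : ℂ := ∑' k, waveTerm g (lac k)⁻¹ ξ

lemma norm_waveTerm (g : ℝ → ℂ) (r : ℝ) (ξ : FreqPlane) :
    ‖waveTerm g r ξ‖ = ‖g (r * (ξ 0 + ξ 1))‖ := by
  rw [waveTerm, norm_mul, norm_unitExp, mul_one]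

lemma IsProfile.bounded {g : ℝ → ℂ} (hg : IsProfile g) : ∃ C, 0 ≤ C ∧ ∀ w, ‖g w‖ ≤ C := by
  obtain ⟨C, hC⟩ := (isCompact_Icc (a := (1 / 2 : ℝ)) (b := 3 / 2)).exists_bound_of_continuousOn
    hg.contDiff.continuous.continuousOn
  refine ⟨max C 0, le_max_right _ _, fun w => ?_⟩
  by_cases hw : w ∈ Set.Icc (1 / 2 : ℝ) (3 / 2)
  · exact (hC w hw).trans (le_max_left _ _)
  · rw [hg.eq_zero w hw]; simp

lemma IsProfile.deriv_add {g : ℝ → ℂ} (hg : IsProfile g) (c : ℂ) :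
    IsProfile (fun w => deriv g w + c * g w) where
  contDiff := by
    have h1 : ContDiff ℝ ∞ (deriv g) := (contDiff_infty_iff_deriv.1 hg.contDiff).2
    exact h1.add (contDiff_const.mul hg.contDiff)
  eq_zero w hw := by
    have h : g =ᶠ[𝓝 w] fun _ => 0 := by
      filter_upwards [isClosed_Icc.isOpen_compl.mem_nhds hw] with z hz using hg.eq_zero z hz
    rw [h.deriv_eq, hg.eq_zero w hw]
    simp

lemma contDiff_waveTerm {g : ℝ → ℂ} (hg : ContDiff ℝ ∞ g) (r : ℝ) :
    ContDiff ℝ ∞ (waveTerm g r) := by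
  have h (i : Fin 2) : ContDiff ℝ ∞ (fun ξ : FreqPlane => ξ i) := by fun_prop
  exact (hg.comp (contDiff_const.mul ((h 0).add (h 1)))).mul
    (contDiff_unitExp.comp (contDiff_const.mul ((h 0).sub (h 1))))

/-- The derivative falls on g, giving r g', or on the character, giving ±2πi r/4 = ±r(π/2)i. Either
way one factor r comes out and a packet with a new profile remains, so the computation iterates. -/
lemma partialDeriv_const_mul_waveTerm {g : ℝ → ℂ} (hg : IsProfile g) (i : Fin 2) (c : ℂ) (r : ℝ) :
    partialDeriv i (fun ξ => c * waveTerm g r ξ) = fun ξ => c * r *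
      waveTerm (fun w => deriv g w + (if i = 0 then 1 else -1) * (Real.pi / 2 * Complex.I) * g w)
        r ξ := by
  funext ξ
  set s : ℝ := if i = 0 then 1 else -1 with hs
  have hlin (a b : ℝ) (t : ℝ) : HasDerivAt (fun t : ℝ => r * (a + b * t)) (r * b) t := by
    simpa using (((hasDerivAt_id t).const_mul b).const_add a).const_mul r
  have hlin' (a b : ℝ) (t : ℝ) : HasDerivAt (fun t : ℝ => r / 4 * (a + b * t)) (r / 4 * b) t := by
    simpa using (((hasDerivAt_id t).const_mul b).const_add a).const_mul (r / 4)
  have hgd (w : ℝ) : HasDerivAt g (deriv g w) w :=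
    ((hg.contDiff.differentiable (by simp)) w).hasDerivAt
  have h1 := HasDerivAt.scomp (0 : ℝ) (hgd _) (hlin (ξ 0 + ξ 1) 1 0)
  have h2 := HasDerivAt.scomp (0 : ℝ) (hasDerivAt_unitExp _) (hlin' (ξ 0 - ξ 1) s 0)
  have h3 := (h1.mul h2).const_mul c
  have key : (fun t : ℝ => c * waveTerm g r (ξ + t • EuclideanSpace.single i 1)) =
      fun t : ℝ => c * ((g ∘ fun t : ℝ => r * (ξ 0 + ξ 1 + 1 * t)) *
        (unitExp ∘ fun t : ℝ => r / 4 * (ξ 0 - ξ 1 + s * t))) t := by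
    funext t
    simp only [waveTerm, Pi.mul_apply, Function.comp]
    fin_cases i
    · simp [hs]; left; congr 2 <;> ring
    · simp [hs]; left; congr 2 <;> ring
  rw [← key] at h3
  have h4 := HasLineDerivAt.lineDeriv (𝕜 := ℝ) (f := fun ξ => c * waveTerm g r ξ) h3
  rw [partialDeriv, h4, waveTerm]
  simp only [Function.comp, mul_zero, add_zero, Complex.real_smul]
  have hsc : (s : ℂ) = if i = 0 then 1 else -1 := by rw [hs]; split_ifs <;> simp
  rw [← hsc]
  push_cast
  ring

lemma iterate_partialDeriv_waveTerm {g : ℝ → ℂ} (hg : IsProfile g) (i : Fin 2) (n : ℕ) :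
    ∃ g', IsProfile g' ∧ ∀ (c : ℂ) (r : ℝ), (partialDeriv i)^[n] (fun ξ => c * waveTerm g r ξ) =
      fun ξ => c * r ^ n * waveTerm g' r ξ := by
  induction n with
  | zero => exact ⟨g, hg, fun c r => by simp⟩
  | succ n ih =>
    obtain ⟨g', hg', h⟩ := ih
    refine ⟨_, hg'.deriv_add ((if i = 0 then 1 else -1) * (Real.pi / 2 * Complex.I)),
      fun c r => ?_⟩
    rw [Function.iterate_succ_apply', h, partialDeriv_const_mul_waveTerm hg']
    simp only [pow_succ, mul_assoc]

lemma multiDeriv_waveTerm {g : ℝ → ℂ} (hg : IsProfile g) (α : Fin 2 → ℕ) :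
    ∃ g', IsProfile g' ∧ ∀ (r : ℝ), multiDeriv α (waveTerm g r) =
      fun ξ => (r : ℂ) ^ (α 0 + α 1) * waveTerm g' r ξ := by
  obtain ⟨g₁, hg₁, h₁⟩ := iterate_partialDeriv_waveTerm hg 1 (α 1)
  obtain ⟨g₂, hg₂, h₂⟩ := iterate_partialDeriv_waveTerm hg₁ 0 (α 0)
  refine ⟨g₂, hg₂, fun r => ?_⟩
  have h := h₁ 1 r
  simp only [one_mul] at h
  rw [multiDeriv, show waveTerm g r = fun ξ => waveTerm g r ξ from rfl, h, h₂]
  simp only [pow_add, mul_comm]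

lemma eventuallyEq_iterate_partialDeriv {m m' : FreqPlane → ℂ} {ξ : FreqPlane} (i : Fin 2)
    (h : m =ᶠ[𝓝 ξ] m') (n : ℕ) : (partialDeriv i)^[n] m =ᶠ[𝓝 ξ] (partialDeriv i)^[n] m' := by
  induction n with
  | zero => exact h
  | succ n ih =>
    rw [Function.iterate_succ_apply', Function.iterate_succ_apply']
    filter_upwards [eventually_eventually_nhds.2 ih] with η hη
    exact Filter.EventuallyEq.lineDeriv_eq hη

lemma multiDeriv_congr {m m' : FreqPlane → ℂ} {ξ : FreqPlane} (α : Fin 2 → ℕ)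
    (h : m =ᶠ[𝓝 ξ] m') : multiDeriv α m ξ = multiDeriv α m' ξ :=
  (eventuallyEq_iterate_partialDeriv 0 (eventuallyEq_iterate_partialDeriv 1 h _) _).eq_of_nhds

lemma waveTerm_eq_zero {g : ℝ → ℂ} (hg : IsProfile g) {k : ℕ} {ξ : FreqPlane}
    (h : ξ 0 + ξ 1 < lac k / 2 ∨ 3 / 2 * lac k < ξ 0 + ξ 1) : waveTerm g (lac k)⁻¹ ξ = 0 := by
  rw [waveTerm, hg.eq_zero, zero_mul]
  have := lac_pos k
  rintro ⟨h1, h2⟩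
  rw [inv_mul_eq_div, le_div_iff₀ this] at h1
  rw [inv_mul_eq_div, div_le_iff₀ this] at h2
  rcases h with h | h <;> linarith

lemma exists_lacSymbol_eventuallyEq {g : ℝ → ℂ} (hg : IsProfile g) (ξ : FreqPlane) :
    ∃ k, ∀ᶠ η in 𝓝 ξ, (∀ j ≠ k, waveTerm g (lac j)⁻¹ η = 0) := by
  classical
  have hc : Continuous (fun η : FreqPlane => η 0 + η 1) := by fun_prop
  -- Minimality gives u ≥ λ_{j+1}/2 ≥ 2λ_j for j < k, strictly beyond the support of packet j;
  -- packets j > k start at λ_{k+1}/2 or later. Both inequalities are open, so they persist near ξ.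
  set k := Nat.find (exists_lt_lac (ξ 0 + ξ 1)) with hk
  have h1 : ξ 0 + ξ 1 < lac (k + 1) / 2 := Nat.find_spec (exists_lt_lac (ξ 0 + ξ 1))
  have h2 : ∀ j < k, 3 / 2 * lac j < ξ 0 + ξ 1 := by
    intro j hj
    have := Nat.find_min (exists_lt_lac (ξ 0 + ξ 1)) hj
    have h4 := four_mul_lac_le (Nat.lt_succ_self j)
    have := lac_pos j
    simp only [Nat.succ_eq_add_one] at h4
    linarith
  have h3 : ∀ᶠ η : FreqPlane in 𝓝 ξ, ∀ j ∈ Finset.range k, 3 / 2 * lac j < η 0 + η 1 := by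
    rw [Finset.eventually_all]
    intro j hj
    exact hc.continuousAt.eventually (lt_mem_nhds (h2 j (Finset.mem_range.1 hj)))
  refine ⟨k, ?_⟩
  filter_upwards [h3, hc.continuousAt.eventually (gt_mem_nhds h1)] with η hη1 hη2 j hj
  apply waveTerm_eq_zero hg
  rcases lt_or_gt_of_ne hj with hj | hj
  · exact Or.inr (hη1 j (Finset.mem_range.2 hj))
  · left
    refine hη2.trans_le ?_
    rcases (Nat.succ_le_of_lt hj).eq_or_lt with h | h
    · rw [← h]
    · have := four_mul_lac_le h
      have := lac_pos (k + 1)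
      simp only [Nat.succ_eq_add_one] at *
      linarith

/-- Near each point the symbol is a single packet, whose derivative of order |α| is r^{|α|} times a
bounded packet. On the support of the latter, r u ≤ 3/2, and dist(ξ, Γ) ≤ |u|, which trades r^{|α|}
for dist^{-|α|}. -/
lemma isAdaptedToLine_lacSymbol {g : ℝ → ℂ} (hg : IsProfile g) :
    IsAdaptedToLine (lacSymbol g) := by
  have hloc (ξ : FreqPlane) : ∃ k, lacSymbol g =ᶠ[𝓝 ξ] waveTerm g (lac k)⁻¹ := by
    obtain ⟨k, hk⟩ := exists_lacSymbol_eventuallyEq hg ξ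
    exact ⟨k, hk.mono fun η hη => tsum_eq_single k hη⟩
  refine ⟨fun ξ _ => ?_, fun α => ?_⟩
  · obtain ⟨k, hk⟩ := hloc ξ
    exact ((contDiff_waveTerm hg.contDiff _).contDiffAt.congr_of_eventuallyEq hk).contDiffWithinAt
  · obtain ⟨g', hg', h⟩ := multiDeriv_waveTerm hg α
    obtain ⟨C, hC0, hC⟩ := hg'.bounded
    refine ⟨(3 / 2) ^ (α 0 + α 1) * C, fun ξ hξ => ?_⟩
    obtain ⟨k, hk⟩ := hloc ξ
    have hl := lac_pos k
    have hclosed : IsClosed singularLine :=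
      isClosed_eq (f := fun η : FreqPlane => η 0 + η 1) (by fun_prop) continuous_const
    have hd : 0 < Metric.infDist ξ singularLine :=
      (hclosed.notMem_iff_infDist_pos ⟨0, by simp [singularLine]⟩).1 hξ
    have hdle : Metric.infDist ξ singularLine ≤ |ξ 0 + ξ 1| := by
      have hmem : ξ - (ξ 0 + ξ 1) • EuclideanSpace.single 0 (1 : ℝ) ∈ singularLine := by
        simp [singularLine]
      refine (Metric.infDist_le_dist_of_mem hmem).trans (le_of_eq ?_)
      rw [dist_eq_norm, sub_sub_cancel, norm_smul]
      simp
    rw [multiDeriv_congr α hk, h, norm_mul, norm_pow, Complex.norm_real, norm_waveTerm,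
      le_div_iff₀ (by positivity)]
    by_cases hw : (lac k)⁻¹ * (ξ 0 + ξ 1) ∈ Set.Icc (1 / 2 : ℝ) (3 / 2)
    · have h2 : ‖(lac k)⁻¹‖ * Metric.infDist ξ singularLine ≤ 3 / 2 := by
        refine (mul_le_mul_of_nonneg_left hdle (norm_nonneg _)).trans ?_
        rw [Real.norm_eq_abs, ← abs_mul, abs_of_nonneg (by linarith [hw.1])]
        exact hw.2
      calc _ = (‖(lac k)⁻¹‖ * Metric.infDist ξ singularLine) ^ (α 0 + α 1) *
            ‖g' ((lac k)⁻¹ * (ξ 0 + ξ 1))‖ := by rw [mul_pow]; ring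
        _ ≤ _ := by gcongr; exact hC _
    · rw [hg'.eq_zero _ hw]
      simp only [norm_zero, mul_zero, zero_mul]
      positivity

lemma tsum_enorm_waveTerm_le {g : ℝ → ℂ} (hg : IsProfile g) {C : ℝ≥0} (hC : ∀ w, ‖g w‖₊ ≤ C)
    (ξ : FreqPlane) : ∑' k, ‖waveTerm g (lac k)⁻¹ ξ‖ₑ ≤ C := by
  obtain ⟨k, hk⟩ := exists_lacSymbol_eventuallyEq hg ξ
  rw [tsum_eq_single k (fun j hj => by rw [hk.self_of_nhds j hj, enorm_zero])]
  have := hC ((lac k)⁻¹ * (ξ 0 + ξ 1))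
  rw [← NNReal.coe_le_coe, coe_nnnorm, ← norm_waveTerm, ← coe_nnnorm, NNReal.coe_le_coe] at this
  exact_mod_cast this

/-! ### The operator in physical space -/

lemma fourier_eq_integral_unitExp (f : ℝ → ℂ) (w : ℝ) :
    𝓕 f w = ∫ y, f y * unitExp (-(y * w)) := by
  rw [Real.fourier_real_eq_integral_exp_smul]
  refine integral_congr_ae (ae_of_all _ fun y => ?_)
  simp only [smul_eq_mul, unitExp]
  rw [mul_comm]
  congr 3
  push_cast
  ring

lemma integral_fourier_mul_unitExp (f : 𝓢(ℝ, ℂ)) (z : ℝ) :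
    ∫ s, 𝓕 (f : ℝ → ℂ) s * unitExp (z * s) = f z := by
  have h : 𝓕⁻ (𝓕 (f : ℝ → ℂ)) z = f z := by
    have : 𝓕⁻ (𝓕 f) = f := FourierTransform.fourierInv_fourier_eq f
    rw [← SchwartzMap.fourier_coe, ← SchwartzMap.fourierInv_coe, this]
  rw [← h, Real.fourierInv_eq_fourier_neg, fourier_eq_integral_unitExp]
  refine integral_congr_ae (ae_of_all _ fun y => ?_)
  simp only
  congr 2
  ring

lemma integrable_fourier (f : 𝓢(ℝ, ℂ)) : Integrable (𝓕 (f : ℝ → ℂ)) := (𝓕 f).integrable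

lemma continuous_fourier (f : 𝓢(ℝ, ℂ)) : Continuous (𝓕 (f : ℝ → ℂ)) := (𝓕 f).continuous

lemma measurePreserving_freqPlane :
    MeasurePreserving (fun ξ : FreqPlane => (ξ 0, ξ 1)) volume (volume : Measure (ℝ × ℝ)) :=
  (volume_preserving_finTwoArrow ℝ).comp
    (EuclideanSpace.volume_preserving_symm_measurableEquiv_toLp (Fin 2))

lemma integral_freqPlane (G : ℝ × ℝ → ℂ) : ∫ ξ : FreqPlane, G (ξ 0, ξ 1) = ∫ p, G p :=
  measurePreserving_freqPlane.integral_comp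
    ((MeasurableEquiv.toLp 2 (Fin 2 → ℝ)).symm.trans
      MeasurableEquiv.finTwoArrow).measurableEmbedding G

lemma integrable_fourier_prod (f₁ f₂ : 𝓢(ℝ, ℂ)) :
    Integrable (fun p : ℝ × ℝ => 𝓕 (f₁ : ℝ → ℂ) p.1 * 𝓕 (f₂ : ℝ → ℂ) p.2) :=
  (integrable_fourier f₁).mul_prod (integrable_fourier f₂)

/-- One wave packet acts by averaging the shifted products `f₁(z + r/4) f₂(z - r/4)`. -/
lemma integral_waveTerm (ψ f₁ f₂ : 𝓢(ℝ, ℂ)) (r x : ℝ) :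
    ∫ ξ : FreqPlane, waveTerm (𝓕 (ψ : ℝ → ℂ)) r ξ * 𝓕 (f₁ : ℝ → ℂ) (ξ 0) * 𝓕 (f₂ : ℝ → ℂ) (ξ 1) *
      unitExp (x * (ξ 0 + ξ 1)) =
    ∫ y, ψ y * (f₁ (x - r * y + r / 4) * f₂ (x - r * y - r / 4)) := by
  set K : ℝ × ℝ → ℝ → ℂ := fun p y =>
    ψ y * ((𝓕 (f₁ : ℝ → ℂ) p.1 * unitExp ((x - r * y + r / 4) * p.1)) *
      (𝓕 (f₂ : ℝ → ℂ) p.2 * unitExp ((x - r * y - r / 4) * p.2))) with hK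
  have hcf := continuous_fourier
  have hu := continuous_unitExp
  have hint : Integrable (Function.uncurry K) (volume.prod volume) := by
    have h := (integrable_fourier_prod f₁ f₂).mul_prod ψ.integrable (ν := volume) (μ := volume)
    refine h.mono ?_ (ae_of_all _ fun q => ?_)
    · refine Continuous.aestronglyMeasurable ?_
      have h1 := hcf f₁
      have h2 := hcf f₂
      have h3 := ψ.continuous
      simp only [hK, Function.uncurry_def]
      fun_prop
    · simp only [hK, Function.uncurry_def, norm_mul, norm_unitExp, mul_one]
      rw [mul_comm]
  calc _ = ∫ p : ℝ × ℝ, ∫ y, K p y := by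
        rw [← integral_freqPlane]
        refine integral_congr_ae (ae_of_all _ fun ξ => ?_)
        simp only [waveTerm, fourier_eq_integral_unitExp ψ, hK]
        simp only [← integral_mul_const]
        refine integral_congr_ae (ae_of_all _ fun y => ?_)
        have e : unitExp ((x - r * y + r / 4) * ξ 0) * unitExp ((x - r * y - r / 4) * ξ 1) =
            unitExp (-(y * (r * (ξ 0 + ξ 1)))) * unitExp (r / 4 * (ξ 0 - ξ 1)) *
              unitExp (x * (ξ 0 + ξ 1)) := by
          simp only [← unitExp_add]
          congr 1
          ring
        simp only
        linear_combination (-(ψ y) * 𝓕 (f₁ : ℝ → ℂ) (ξ 0) * 𝓕 (f₂ : ℝ → ℂ) (ξ 1)) * e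
    _ = ∫ y, ∫ p : ℝ × ℝ, K p y := integral_integral_swap hint
    _ = _ := by
        refine integral_congr_ae (ae_of_all _ fun y => ?_)
        simp only [hK]
        rw [integral_const_mul, Measure.volume_eq_prod, integral_prod_mul
          (fun s => 𝓕 (f₁ : ℝ → ℂ) s * unitExp ((x - r * y + r / 4) * s))
          (fun s => 𝓕 (f₂ : ℝ → ℂ) s * unitExp ((x - r * y - r / 4) * s)),
          integral_fourier_mul_unitExp, integral_fourier_mul_unitExp]

/-- Sum and integral may be exchanged because at most one packet is nonzero at each point, so the
absolute sum is dominated by a constant times the integrable |f̂₁ f̂₂|. -/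
lemma bilinearMultiplier_lacSymbol (ψ : 𝓢(ℝ, ℂ)) (hψ : IsProfile (𝓕 (ψ : ℝ → ℂ)))
    (f₁ f₂ : 𝓢(ℝ, ℂ)) (x : ℝ) :
    bilinearMultiplier (lacSymbol (𝓕 (ψ : ℝ → ℂ))) f₁ f₂ x =
      ∑' k, ∫ y, ψ y * (f₁ (x - (lac k)⁻¹ * y + (lac k)⁻¹ / 4) *
        f₂ (x - (lac k)⁻¹ * y - (lac k)⁻¹ / 4)) := by
  set G : FreqPlane → ℂ := fun ξ => 𝓕 (f₁ : ℝ → ℂ) (ξ 0) * 𝓕 (f₂ : ℝ → ℂ) (ξ 1) with hG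
  have hGi : Integrable G :=
    measurePreserving_freqPlane.integrable_comp_of_integrable (integrable_fourier_prod f₁ f₂)
  set F : ℕ → FreqPlane → ℂ := fun k ξ => waveTerm (𝓕 (ψ : ℝ → ℂ)) (lac k)⁻¹ ξ *
    𝓕 (f₁ : ℝ → ℂ) (ξ 0) * 𝓕 (f₂ : ℝ → ℂ) (ξ 1) * unitExp (x * (ξ 0 + ξ 1)) with hF
  have hFn (k : ℕ) (ξ : FreqPlane) :
      ‖F k ξ‖ₑ = ‖waveTerm (𝓕 (ψ : ℝ → ℂ)) (lac k)⁻¹ ξ‖ₑ * ‖G ξ‖ₑ := by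
    rw [← enorm_mul, ← ofReal_norm, ← ofReal_norm]
    simp only [hF, hG, norm_mul, norm_unitExp, mul_one, mul_assoc]
  have hFc (k : ℕ) : Continuous (F k) := by
    have h1 := continuous_fourier f₁
    have h2 := continuous_fourier f₂
    have h3 := (contDiff_waveTerm hψ.contDiff (lac k)⁻¹).continuous
    have h4 := continuous_unitExp
    simp only [hF]
    fun_prop
  obtain ⟨C, hC0, hC⟩ := hψ.bounded
  have hsum : ∑' k, ∫⁻ ξ, ‖F k ξ‖ₑ ≠ ⊤ := by
    rw [← lintegral_tsum fun k => (hFc k).enorm.measurable.aemeasurable]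
    have h2 : ∫⁻ ξ, ∑' k, ‖F k ξ‖ₑ ≤ ∫⁻ ξ, (C.toNNReal : ℝ≥0∞) * ‖G ξ‖ₑ := by
      refine lintegral_mono fun ξ => ?_
      simp only [hFn, ENNReal.tsum_mul_right]
      gcongr
      refine tsum_enorm_waveTerm_le hψ (fun w => ?_) ξ
      rw [← NNReal.coe_le_coe, coe_nnnorm, Real.coe_toNNReal _ hC0]
      exact hC w
    refine ne_top_of_le_ne_top ?_ h2
    rw [lintegral_const_mul' _ _ ENNReal.coe_ne_top]
    exact ENNReal.mul_ne_top ENNReal.coe_ne_top hGi.2.ne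
  have key := integral_tsum (fun k => (hFc k).aestronglyMeasurable) hsum
  simp only [← integral_waveTerm]
  rw [← key, bilinearMultiplier]
  refine integral_congr_ae (ae_of_all _ fun ξ => ?_)
  simp only [hF, lacSymbol, tsum_mul_right, unitExp]
  congr 2
  push_cast
  ring

/-! ### Lacunary sums are large on a set of fixed measure -/

lemma unitExp_conj (θ : ℝ) : (starRingEnd ℂ) (unitExp θ) = unitExp (-θ) := by
  rw [unitExp, unitExp, ← Complex.exp_conj]
  congr 1
  simp only [map_mul, Complex.conj_ofReal, Complex.conj_I]
  push_cast
  ring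

lemma unitExp_int (n : ℤ) : unitExp n = 1 := by
  rw [unitExp, Complex.exp_eq_one_iff]
  exact ⟨n, by push_cast; ring⟩

lemma integral_unitExp_int_mul (n : ℤ) :
    ∫ x in (0 : ℝ)..1, unitExp (n * x) = if n = 0 then 1 else 0 := by
  split_ifs with h
  · simp [h, unitExp_zero]
  · have hd (x : ℝ) : HasDerivAt (fun x : ℝ => (2 * Real.pi * Complex.I * n)⁻¹ * unitExp (n * x))
        (unitExp (n * x)) x := by
      have h1 := (HasDerivAt.scomp x (hasDerivAt_unitExp (n * x))
        ((hasDerivAt_id x).const_mul (n : ℝ))).const_mul (2 * Real.pi * Complex.I * n)⁻¹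
      refine h1.congr_deriv ?_
      have hn : (n : ℂ) ≠ 0 := by exact_mod_cast h
      have hp : (Real.pi : ℂ) ≠ 0 := by exact_mod_cast Real.pi_ne_zero
      simp only [Complex.real_smul]
      push_cast
      field_simp
    rw [intervalIntegral.integral_eq_sub_of_hasDerivAt (fun x _ => hd x)
      ((continuous_unitExp.comp (continuous_const.mul continuous_id)).intervalIntegrable _ _)]
    simp [unitExp_zero, unitExp_int]

/-- The exponential sum `∑_{k < N} e^{2πi λ_k x}` over the lacunary frequencies. -/
noncomputable def lacSum (N : ℕ) (x : ℝ) : ℂ := ∑ k ∈ Finset.range N, unitExp (lac k * x)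

lemma continuous_lacSum (N : ℕ) : Continuous (lacSum N) := by
  have := continuous_unitExp
  unfold lacSum
  fun_prop

lemma strictMono_lac : StrictMono lac := fun j k h => by
  linarith [four_mul_lac_le h, lac_pos j]

/-- The lacunary frequencies form a Sidon set. -/
lemma lac_add_eq {a b c d : ℕ} (h : lac a + lac b = lac c + lac d) :
    (a = c ∧ b = d) ∨ (a = d ∧ b = c) := by
  have key : ∀ {a b c d : ℕ}, b ≤ a → d ≤ c → lac a + lac b = lac c + lac d → a = c ∧ b = d := by
    intro a b c d hab hcd h
    have hm := strictMono_lac.monotone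
    have h1 := hm hab
    have h2 := hm hcd
    have := lac_pos b
    have := lac_pos d
    have hac : a = c := by
      rcases lt_trichotomy a c with h' | h' | h'
      · linarith [four_mul_lac_le h']
      · exact h'
      · linarith [four_mul_lac_le h']
    subst hac
    exact ⟨rfl, strictMono_lac.injective (by linarith)⟩
  rcases le_total b a with h1 | h1 <;> rcases le_total d c with h2 | h2
  · exact Or.inl (key h1 h2 h)
  · exact Or.inr (key h1 h2 (by linarith))
  · exact Or.inr (key h1 h2 (by linarith)).symm
  · exact Or.inl (key h1 h2 (by linarith)).symm

lemma norm_sq_lacSum (N : ℕ) (x : ℝ) : ((‖lacSum N x‖ ^ 2 : ℝ) : ℂ) =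
    ∑ j ∈ Finset.range N, ∑ k ∈ Finset.range N, unitExp ((lac j - lac k) * x) := by
  rw [← Complex.normSq_eq_norm_sq, ← Complex.mul_conj, lacSum, map_sum, Finset.sum_mul_sum]
  refine Finset.sum_congr rfl fun j _ => Finset.sum_congr rfl fun k _ => ?_
  rw [unitExp_conj, ← unitExp_add]
  congr 1
  ring

lemma intervalIntegral_lac (n : ℤ) (t : ℝ) (h : t = n) :
    ∫ x in (0 : ℝ)..1, unitExp (t * x) = if t = 0 then 1 else 0 := by
  subst h
  rw [integral_unitExp_int_mul]
  simp

lemma exists_int_lac (k : ℕ) : ∃ n : ℤ, lac k = n := ⟨4 ^ (k ^ 2), by simp [lac]⟩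

lemma intervalIntegrable_unitExp (t : ℝ) :
    IntervalIntegrable (fun x => unitExp (t * x)) volume 0 1 :=
  (continuous_unitExp.comp (continuous_const.mul continuous_id)).intervalIntegrable _ _

lemma integral_sum_sum_unitExp {ι : Type*} (A : Finset ι) (c : ι → ι → ℝ) :
    ∫ x in (0 : ℝ)..1, ∑ j ∈ A, ∑ k ∈ A, unitExp (c j k * x) =
      ∑ j ∈ A, ∑ k ∈ A, ∫ x in (0 : ℝ)..1, unitExp (c j k * x) := by
  simp only [← Finset.sum_product']
  exact intervalIntegral.integral_finsetSum fun p _ => intervalIntegrable_unitExp _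

lemma integral_norm_sq_lacSum (N : ℕ) : ∫ x in (0 : ℝ)..1, ‖lacSum N x‖ ^ 2 = N := by
  rw [← Complex.ofReal_inj, ← intervalIntegral.integral_ofReal]
  simp only [norm_sq_lacSum]
  have hI (j k : ℕ) : ∫ x in (0 : ℝ)..1, unitExp ((lac j - lac k) * x) =
      if j = k then 1 else 0 := by
    obtain ⟨a, ha⟩ := exists_int_lac j
    obtain ⟨b, hb⟩ := exists_int_lac k
    rw [intervalIntegral_lac (a - b) _ (by rw [ha, hb]; push_cast; ring)]
    simp only [sub_eq_zero, strictMono_lac.injective.eq_iff]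
  simp only [integral_sum_sum_unitExp, hI]
  rw [Finset.sum_congr rfl fun j hj => by rw [Finset.sum_ite_eq, if_pos hj]]
  simp

/-- Expanding the fourth power leaves the quadruples with λ_{p₁} + λ_{q₁} = λ_{p₂} + λ_{q₂}. By the
Sidon property these form two diagonal families, of at most N² members each. -/
lemma integral_norm_pow_four_lacSum_le (N : ℕ) :
    ∫ x in (0 : ℝ)..1, (‖lacSum N x‖ ^ 2) ^ 2 ≤ 2 * (N : ℝ) ^ 2 := by
  set R := Finset.range N ×ˢ Finset.range N with hR
  have hsq (x : ℝ) : (((‖lacSum N x‖ ^ 2) ^ 2 : ℝ) : ℂ) =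
      ∑ p ∈ R, ∑ q ∈ R, unitExp ((lac p.1 - lac p.2 + (lac q.1 - lac q.2)) * x) := by
    rw [Complex.ofReal_pow, norm_sq_lacSum, ← Finset.sum_product', sq, Finset.sum_mul_sum]
    simp only [add_mul, unitExp_add, hR]
  have hI (p q : ℕ × ℕ) :
      ∫ x in (0 : ℝ)..1, unitExp ((lac p.1 - lac p.2 + (lac q.1 - lac q.2)) * x) =
        ((if lac p.1 - lac p.2 + (lac q.1 - lac q.2) = 0 then 1 else 0 : ℝ) : ℂ) := by
    obtain ⟨a, ha⟩ := exists_int_lac p.1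
    obtain ⟨b, hb⟩ := exists_int_lac p.2
    obtain ⟨c, hc⟩ := exists_int_lac q.1
    obtain ⟨d, hd⟩ := exists_int_lac q.2
    rw [intervalIntegral_lac (a - b + (c - d)) _ (by rw [ha, hb, hc, hd]; push_cast; ring)]
    split_ifs <;> simp
  have hval : ∫ x in (0 : ℝ)..1, (‖lacSum N x‖ ^ 2) ^ 2 =
      ∑ p ∈ R, ∑ q ∈ R, if lac p.1 - lac p.2 + (lac q.1 - lac q.2) = 0 then (1 : ℝ) else 0 := by
    rw [← Complex.ofReal_inj, ← intervalIntegral.integral_ofReal]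
    simp only [hsq]
    rw [integral_sum_sum_unitExp R fun p q => lac p.1 - lac p.2 + (lac q.1 - lac q.2)]
    simp only [hI]
    push_cast
    rfl
  rw [hval]
  have hle (p q : ℕ × ℕ) : (if lac p.1 - lac p.2 + (lac q.1 - lac q.2) = 0 then (1 : ℝ) else 0) ≤
      (if p.1 = p.2 then 1 else 0) * (if q.1 = q.2 then 1 else 0) +
      (if q = (p.2, p.1) then 1 else 0) := by
    by_cases h : lac p.1 - lac p.2 + (lac q.1 - lac q.2) = 0
    · rw [if_pos h]
      rcases lac_add_eq (a := p.1) (b := q.1) (c := p.2) (d := q.2) (by linarith) with h' | h'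
      · rw [if_pos h'.1, if_pos h'.2]
        split_ifs <;> norm_num
      · rw [if_pos (Prod.ext h'.2 h'.1.symm)]
        split_ifs <;> norm_num
    · rw [if_neg h]
      split_ifs <;> norm_num
  calc _ ≤ ∑ p ∈ R, ∑ q ∈ R, ((if p.1 = p.2 then 1 else 0) * (if q.1 = q.2 then 1 else 0) +
      (if q = (p.2, p.1) then (1 : ℝ) else 0)) :=
        Finset.sum_le_sum fun p _ => Finset.sum_le_sum fun q _ => hle p q
    _ ≤ _ := by
        have hd : ∑ p ∈ R, (if p.1 = p.2 then (1 : ℝ) else 0) = N := by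
          rw [hR, Finset.sum_product,
            Finset.sum_congr rfl fun j hj => by rw [Finset.sum_ite_eq, if_pos hj]]
          simp
        have hs : ∑ p ∈ R, ∑ q ∈ R, (if q = (p.2, p.1) then (1 : ℝ) else 0) ≤ (N : ℝ) ^ 2 := by
          calc _ ≤ ∑ p ∈ R, (1 : ℝ) := by
                refine Finset.sum_le_sum fun p _ => ?_
                rw [Finset.sum_ite_eq']
                split_ifs <;> norm_num
            _ = _ := by simp [hR, sq]
        simp only [Finset.sum_add_distrib, ← Finset.sum_mul_sum, hd]
        linarith

/-- The set where the lacunary sum has at least half of its mean square. -/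
def lacLarge (N : ℕ) : Set ℝ := {x ∈ Set.Ioc (0 : ℝ) 1 | (N : ℝ) / 2 ≤ ‖lacSum N x‖ ^ 2}

lemma measurableSet_lacLarge (N : ℕ) : MeasurableSet (lacLarge N) :=
  measurableSet_Ioc.inter (measurableSet_le measurable_const
    ((continuous_lacSum N).norm.pow 2).measurable)

/-- A Paley–Zygmund argument with Z = |S_N|². Off the set Z ≤ N/2; on it (Z - 4N)² ≥ 0 gives Z ≤
Z²/(8N) + 2N. Integrating, N ≤ N/2 + N/4 + 2N·|E|. -/
lemma volume_lacLarge {N : ℕ} (hN : 0 < N) : 1 / 8 ≤ volume (lacLarge N) := by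
  have hN' : (0 : ℝ) < N := by exact_mod_cast hN
  have hcont : Continuous fun x => ‖lacSum N x‖ ^ 2 := (continuous_lacSum N).norm.pow 2
  have hpt (x : ℝ) (hx : x ∈ Set.Ioc (0 : ℝ) 1) : ‖lacSum N x‖ ^ 2 ≤
      N / 2 + (‖lacSum N x‖ ^ 2) ^ 2 / (8 * N) +
        2 * N * (lacLarge N).indicator (fun _ => (1 : ℝ)) x := by
    set Z := ‖lacSum N x‖ ^ 2 with hZ
    by_cases h : x ∈ lacLarge N
    · rw [Set.indicator_of_mem h]
      have : 0 ≤ (Z - 4 * N) ^ 2 / (8 * N) := by positivity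
      have e : (Z - 4 * N) ^ 2 / (8 * N) = Z ^ 2 / (8 * N) - Z + 2 * N := by field_simp; ring
      linarith
    · rw [Set.indicator_of_notMem h]
      have : ¬ (N : ℝ) / 2 ≤ Z := fun h' => h ⟨hx, h'⟩
      have : 0 ≤ Z ^ 2 / (8 * N) := by positivity
      linarith
  have hfin : volume (lacLarge N) ≠ ⊤ :=
    ne_top_of_le_ne_top (by simp) (measure_mono (fun x hx => hx.1 : lacLarge N ⊆ Set.Ioc (0 : ℝ) 1))
  have hi1 : IntegrableOn (fun x => ‖lacSum N x‖ ^ 2) (Set.Ioc 0 1) :=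
    (hcont.integrableOn_Icc).mono_set Set.Ioc_subset_Icc_self
  have hi2 : IntegrableOn (fun x => (‖lacSum N x‖ ^ 2) ^ 2 / (8 * N)) (Set.Ioc 0 1) :=
    ((hcont.pow 2).div_const _).integrableOn_Icc.mono_set Set.Ioc_subset_Icc_self
  have hi3 : IntegrableOn (fun x => 2 * N * (lacLarge N).indicator (fun _ => (1 : ℝ)) x)
      (Set.Ioc 0 1) :=
    (((integrable_indicator_iff (measurableSet_lacLarge N)).2
      (integrableOn_const hfin)).const_mul _).integrableOn
  have hi0 : IntegrableOn (fun _ => (N : ℝ) / 2) (Set.Ioc (0 : ℝ) 1) :=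
    integrableOn_const (by simp)
  have hi02 : IntegrableOn (fun x => (N : ℝ) / 2 + (‖lacSum N x‖ ^ 2) ^ 2 / (8 * N))
      (Set.Ioc 0 1) := hi0.add hi2
  have hm := setIntegral_mono_on hi1 (hi02.add hi3) measurableSet_Ioc hpt
  simp only [Pi.add_apply] at hm
  rw [integral_add hi02 hi3, integral_add hi0 hi2,
    integral_div (8 * (N : ℝ)) (fun x => (‖lacSum N x‖ ^ 2) ^ 2), integral_const_mul,
    setIntegral_indicator (measurableSet_lacLarge N),
    Set.inter_eq_right.2 (fun x hx => hx.1 : lacLarge N ⊆ Set.Ioc (0 : ℝ) 1)] at hm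
  rw [← intervalIntegral.integral_of_le zero_le_one, integral_norm_sq_lacSum] at hm
  simp only [integral_const, MeasurableSet.univ, measureReal_restrict_apply, Set.univ_inter,
    Real.volume_real_Ioc, smul_eq_mul, mul_one] at hm
  have h4 : (∫ x in Set.Ioc (0 : ℝ) 1, (‖lacSum N x‖ ^ 2) ^ 2) / (8 * N) ≤ N / 4 := by
    rw [← intervalIntegral.integral_of_le zero_le_one, div_le_iff₀ (by positivity)]
    linarith [integral_norm_pow_four_lacSum_le N]
  have h5 : 1 / 8 ≤ volume.real (lacLarge N) := by
    norm_num at hm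
    have : 2 * (N : ℝ) * (1 / 8) ≤ 2 * N * volume.real (lacLarge N) := by linarith
    exact le_of_mul_le_mul_left this (by positivity)
  rw [← ENNReal.ofReal_toReal hfin]
  refine le_trans (le_of_eq ?_) (ENNReal.ofReal_le_ofReal h5)
  rw [ENNReal.ofReal_div_of_pos (by norm_num)]
  simp

/-! ### The test functions -/

/-- A smooth cutoff equal to `1` on `[-1, 2]`. -/
noncomputable def cutoff : ContDiffBump (1 / 2 : ℝ) := ⟨3 / 2, 2, by norm_num, by norm_num⟩

lemma cutoff_eq_one {y : ℝ} (h1 : -1 ≤ y) (h2 : y ≤ 2) : cutoff y = 1 := by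
  apply cutoff.one_of_mem_closedBall
  rw [Real.closedBall_eq_Icc]
  constructor <;> simp only [cutoff] <;> linarith

/-- The cutoff modulated by the phase `e^{iΦ}`. -/
noncomputable def modCutoff {Φ : ℝ → ℝ} (hΦ : ContDiff ℝ ∞ Φ) : 𝓢(ℝ, ℂ) :=
  HasCompactSupport.toSchwartzMap (f := fun y => Complex.exp (Φ y * Complex.I) * (cutoff y : ℂ))
    ((cutoff.hasCompactSupport.comp_left (g := Complex.ofReal) Complex.ofReal_zero).mul_left)
    (((Complex.ofRealCLM.contDiff.comp hΦ).mul contDiff_const).cexp.mul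
      (Complex.ofRealCLM.contDiff.comp cutoff.contDiff))

lemma modCutoff_apply {Φ : ℝ → ℝ} (hΦ : ContDiff ℝ ∞ Φ) (y : ℝ) :
    modCutoff hΦ y = Complex.exp (Φ y * Complex.I) * (cutoff y : ℂ) := rfl

lemma eLpNorm_modCutoff {Φ : ℝ → ℝ} (hΦ : ContDiff ℝ ∞ Φ) (p : ℝ≥0∞) :
    eLpNorm (modCutoff hΦ) p volume = eLpNorm (cutoff : ℝ → ℝ) p volume := by
  refine eLpNorm_congr_norm_ae (ae_of_all _ fun y => ?_)
  rw [modCutoff_apply, norm_mul, Complex.norm_exp_ofReal_mul_I, one_mul, Complex.norm_real]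

lemma eLpNorm_cutoff_lt_top (p : ℝ≥0∞) : eLpNorm (cutoff : ℝ → ℝ) p volume < ⊤ :=
  (cutoff.continuous.memLp_of_hasCompactSupport cutoff.hasCompactSupport).2

/-- The lacunary phase `a ∑_{l < N} sin(2πλ_l y)`. -/
noncomputable def lacPhase (a : ℝ) (N : ℕ) (y : ℝ) : ℝ :=
  a * ∑ l ∈ Finset.range N, Real.sin (2 * Real.pi * (lac l * y))

lemma contDiff_lacPhase (a : ℝ) (N : ℕ) : ContDiff ℝ ∞ (lacPhase a N) := by
  unfold lacPhase
  fun_prop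

/-- The shift r_k/4 puts the argument at exactly π/2 when l = k. For l > k the argument is an
integer multiple of π, since 4 divides λ_l/λ_k; for l < k it is small by the superlacunary growth.
-/
lemma abs_sin_lac_sub_le (l k : ℕ) :
    |Real.sin (2 * Real.pi * (lac l * ((lac k)⁻¹ / 4))) - if l = k then 1 else 0| ≤
      2 * (1 / 4) ^ l * (1 / 4) ^ k := by
  have hk := lac_pos k
  have hl := lac_pos l
  rcases lt_trichotomy l k with h | h | h
  · rw [if_neg h.ne, sub_zero]
    refine Real.abs_sin_le_abs.trans ?_
    rw [abs_of_nonneg (by positivity [Real.pi_pos])]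
    have h1 : lac l * (lac k)⁻¹ ≤ (1 / 4) ^ l * (1 / 4) ^ k := by
      rw [← pow_add, one_div, inv_pow, ← div_eq_mul_inv, div_le_iff₀ hk, ← div_eq_inv_mul,
        le_div_iff₀ (by positivity), mul_comm]
      exact pow_add_mul_lac_le h
    calc _ = Real.pi / 2 * (lac l * (lac k)⁻¹) := by ring
      _ ≤ 2 * (lac l * (lac k)⁻¹) := by gcongr; linarith [Real.pi_le_four]
      _ ≤ 2 * ((1 / 4) ^ l * (1 / 4) ^ k) := by gcongr
      _ = _ := by ring
  · subst h
    rw [if_pos rfl, show 2 * Real.pi * (lac l * ((lac l)⁻¹ / 4)) = Real.pi / 2 by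
      field_simp; norm_num, Real.sin_pi_div_two]
    simp only [sub_self, abs_zero]
    positivity
  · rw [if_neg h.ne']
    have hsq : k ^ 2 + 1 ≤ l ^ 2 := by nlinarith
    obtain ⟨n, hn⟩ := Nat.exists_eq_add_of_le hsq
    have e : lac l = lac k * 4 * 4 ^ n := by
      rw [lac, lac, hn, pow_add, pow_add, pow_one]
    rw [e, show 2 * Real.pi * (lac k * 4 * 4 ^ n * ((lac k)⁻¹ / 4)) =
      ((2 * 4 ^ n : ℕ) : ℝ) * Real.pi by push_cast; field_simp, Real.sin_nat_mul_pi]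
    simp only [sub_self, abs_zero]
    positivity

/-- The amplitude at scale `k` of the phase with `N` frequencies. -/
noncomputable def lacAmp (a : ℝ) (N k : ℕ) : ℝ := if k < N then a else 0

lemma abs_lacPhase_diff_sub_le {a : ℝ} (ha0 : 0 ≤ a) (ha : a ≤ 1 / 2) (N k : ℕ) (z : ℝ) :
    |lacPhase a N (z + (lac k)⁻¹ / 4) - lacPhase a N (z - (lac k)⁻¹ / 4) -
      2 * lacAmp a N k * Real.cos (2 * Real.pi * (lac k * z))| ≤ 8 * (1 / 4) ^ k := by
  have e1 : lacPhase a N (z + (lac k)⁻¹ / 4) - lacPhase a N (z - (lac k)⁻¹ / 4) =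
      ∑ l ∈ Finset.range N, 2 * a * Real.cos (2 * Real.pi * (lac l * z)) *
        Real.sin (2 * Real.pi * (lac l * ((lac k)⁻¹ / 4))) := by
    rw [lacPhase, lacPhase, ← mul_sub, ← Finset.sum_sub_distrib, Finset.mul_sum]
    refine Finset.sum_congr rfl fun l _ => ?_
    simp only [mul_add, mul_sub, Real.sin_add, Real.sin_sub]
    ring
  have e2 : 2 * lacAmp a N k * Real.cos (2 * Real.pi * (lac k * z)) =
      ∑ l ∈ Finset.range N, 2 * a * Real.cos (2 * Real.pi * (lac l * z)) *
        (if l = k then 1 else 0) := by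
    simp only [mul_ite, mul_one, mul_zero, Finset.sum_ite_eq', Finset.mem_range, lacAmp]
    split_ifs <;> simp
  rw [e1, e2, ← Finset.sum_sub_distrib]
  have hgeo : ∑ l ∈ Finset.range N, (1 / 4 : ℝ) ^ l ≤ 4 := by
    have := (summable_geometric_of_lt_one (r := (1 / 4 : ℝ)) (by norm_num)
      (by norm_num)).sum_le_tsum (Finset.range N) (fun _ _ => by positivity)
    rw [tsum_geometric_of_lt_one (by norm_num) (by norm_num)] at this
    norm_num at this ⊢
    linarith
  calc _ ≤ ∑ l ∈ Finset.range N, 2 * (1 / 4 : ℝ) ^ k * (1 / 4) ^ l := by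
        refine (Finset.abs_sum_le_sum_abs _ _).trans (Finset.sum_le_sum fun l _ => ?_)
        rw [← mul_sub, abs_mul, abs_mul, abs_of_nonneg (by linarith : 0 ≤ 2 * a)]
        have h1 := Real.abs_cos_le_one (2 * Real.pi * (lac l * z))
        have h2 := abs_sin_lac_sub_le l k
        calc _ ≤ (2 * (1 / 2 : ℝ)) * 1 * (2 * (1 / 4) ^ l * (1 / 4) ^ k) := by gcongr
          _ = _ := by ring
    _ ≤ _ := by
        rw [← Finset.mul_sum]
        have : (0 : ℝ) < (1 / 4) ^ k := by positivity
        nlinarith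

lemma norm_exp_sub_exp_le (s t : ℝ) :
    ‖Complex.exp (s * Complex.I) - Complex.exp (t * Complex.I)‖ ≤ |s - t| := by
  have e : Complex.exp (s * Complex.I) - Complex.exp (t * Complex.I) =
      Complex.exp (t * Complex.I) * (Complex.exp (Complex.I * (s - t : ℝ)) - 1) := by
    rw [mul_sub, ← Complex.exp_add, mul_one]
    congr 2
    push_cast
    ring
  rw [e, norm_mul, Complex.norm_exp_ofReal_mul_I, one_mul]
  exact Real.norm_exp_I_mul_ofReal_sub_one_le

/-- The second order Taylor polynomial of `e^{iθ}`. -/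
noncomputable def expTaylor (θ : ℝ) : ℂ := 1 + θ * Complex.I - θ ^ 2 / 2

lemma norm_exp_sub_expTaylor_le {θ : ℝ} (h : |θ| ≤ 1) :
    ‖Complex.exp (θ * Complex.I) - expTaylor θ‖ ≤ |θ| ^ 3 := by
  have hn : ‖(θ : ℂ) * Complex.I‖ = |θ| := by simp
  have := Complex.exp_bound (x := θ * Complex.I) (by rw [hn]; exact h) (n := 3) (by norm_num)
  rw [hn] at this
  have e : ∑ m ∈ Finset.range 3, (θ * Complex.I) ^ m / (m.factorial : ℂ) = expTaylor θ := by
    simp [Finset.sum_range_succ, expTaylor, mul_pow, Nat.factorial]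
    ring
  rw [e] at this
  refine this.trans ?_
  norm_num [Nat.factorial]
  nlinarith [pow_nonneg (abs_nonneg θ) 3]

lemma norm_expTaylor_le {θ : ℝ} (h : |θ| ≤ 1) : ‖expTaylor θ‖ ≤ 3 := by
  have h1 := norm_exp_sub_expTaylor_le h
  have h2 : |θ| ^ 3 ≤ 1 := pow_le_one₀ (abs_nonneg _) h
  have h3 := norm_sub_norm_le (expTaylor θ) (Complex.exp (θ * Complex.I))
  rw [Complex.norm_exp_ofReal_mul_I, norm_sub_rev] at h3
  linarith

/-- The product of shifted test functions seen by the wave packet of scale `k`. -/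
noncomputable def shiftedProduct (a : ℝ) (N k : ℕ) (z : ℝ) : ℂ :=
  modCutoff (contDiff_lacPhase a N) (z + (lac k)⁻¹ / 4) *
    modCutoff (contDiff_lacPhase a N).neg (z - (lac k)⁻¹ / 4)

lemma shiftedProduct_eq (a : ℝ) (N k : ℕ) (z : ℝ) : shiftedProduct a N k z =
    Complex.exp ((lacPhase a N (z + (lac k)⁻¹ / 4) - lacPhase a N (z - (lac k)⁻¹ / 4) : ℝ) *
      Complex.I) * ((cutoff (z + (lac k)⁻¹ / 4) * cutoff (z - (lac k)⁻¹ / 4) : ℝ) : ℂ) := by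
  rw [shiftedProduct, modCutoff_apply, modCutoff_apply, mul_mul_mul_comm, ← Complex.exp_add]
  push_cast
  congr 2
  ring

lemma norm_shiftedProduct_le (a : ℝ) (N k : ℕ) (z : ℝ) : ‖shiftedProduct a N k z‖ ≤ 1 := by
  rw [shiftedProduct_eq, norm_mul, Complex.norm_exp_ofReal_mul_I, one_mul, Complex.norm_real,
    Real.norm_of_nonneg (mul_nonneg cutoff.nonneg cutoff.nonneg)]
  exact mul_le_one₀ cutoff.le_one cutoff.nonneg cutoff.le_one

lemma continuous_shiftedProduct (a : ℝ) (N k : ℕ) : Continuous (shiftedProduct a N k) := by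
  have h1 := (modCutoff (contDiff_lacPhase a N)).continuous
  have h2 := (modCutoff (contDiff_lacPhase a N).neg).continuous
  unfold shiftedProduct
  fun_prop

/-- The phase at scale `k` that the wave packet of scale `k` isolates. -/
noncomputable def scalePhase (b : ℝ) (k : ℕ) (z : ℝ) : ℝ :=
  2 * b * Real.cos (2 * Real.pi * (lac k * z))

lemma abs_scalePhase_le {b : ℝ} (hb : 0 ≤ b) (k : ℕ) (z : ℝ) : |scalePhase b k z| ≤ 2 * b := by
  rw [scalePhase, abs_mul, abs_of_nonneg (by linarith : 0 ≤ 2 * b)]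
  exact mul_le_of_le_one_right (by linarith) (Real.abs_cos_le_one _)

lemma lacAmp_nonneg {a : ℝ} (ha : 0 ≤ a) (N k : ℕ) : 0 ≤ lacAmp a N k := by
  unfold lacAmp
  split_ifs <;> simp [ha]

lemma lacAmp_le {a : ℝ} (ha : 0 ≤ a) (N k : ℕ) : lacAmp a N k ≤ a := by
  unfold lacAmp
  split_ifs <;> simp [ha]

/-- The three errors are the Taylor remainder (2b)³, the interaction with other frequencies, and the
cutoffs. The last arises only for |x - z| > 1/2, where 8|x - z| exceeds the trivial bound 1 + 3. -/
lemma norm_shiftedProduct_sub_le {a : ℝ} (ha0 : 0 ≤ a) (ha : a ≤ 1 / 2) (N k : ℕ) {x : ℝ}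
    (hx : x ∈ Set.Icc (0 : ℝ) 1) (z : ℝ) :
    ‖shiftedProduct a N k z - expTaylor (scalePhase (lacAmp a N k) k z)‖ ≤
      8 * lacAmp a N k ^ 3 + 8 * (1 / 4) ^ k + 8 * |x - z| := by
  set b := lacAmp a N k with hb
  have hb0 : 0 ≤ b := lacAmp_nonneg ha0 N k
  have hb1 : b ≤ a := lacAmp_le ha0 N k
  have hθ := abs_scalePhase_le hb0 k z
  have hθ1 : |scalePhase b k z| ≤ 1 := by linarith
  by_cases hxz : |x - z| ≤ 1 / 2
  · have ht : (lac k)⁻¹ / 4 ≤ 1 / 4 := by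
      have := inv_le_one_of_one_le₀ (one_le_lac k)
      linarith
    have ht0 : 0 ≤ (lac k)⁻¹ / 4 := by have := lac_pos k; positivity
    obtain ⟨h1, h2⟩ := abs_le.1 hxz
    obtain ⟨h3, h4⟩ := hx
    rw [shiftedProduct_eq, cutoff_eq_one (by linarith) (by linarith),
      cutoff_eq_one (by linarith) (by linarith), mul_one, Complex.ofReal_one, mul_one]
    have h6 : |lacPhase a N (z + (lac k)⁻¹ / 4) - lacPhase a N (z - (lac k)⁻¹ / 4) -
        scalePhase b k z| ≤ 8 * (1 / 4) ^ k := abs_lacPhase_diff_sub_le ha0 ha N k z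
    have h7 := norm_exp_sub_expTaylor_le hθ1
    have h8 : |scalePhase b k z| ^ 3 ≤ (2 * b) ^ 3 := by gcongr
    have h9 := norm_sub_le_norm_sub_add_norm_sub
      (Complex.exp ((lacPhase a N (z + (lac k)⁻¹ / 4) -
        lacPhase a N (z - (lac k)⁻¹ / 4) : ℝ) * Complex.I))
      (Complex.exp (scalePhase b k z * Complex.I)) (expTaylor (scalePhase b k z))
    have h10 := (norm_exp_sub_exp_le _ _).trans h6
    have := abs_nonneg (x - z)
    calc _ ≤ _ := h9
      _ ≤ 8 * (1 / 4) ^ k + (2 * b) ^ 3 := add_le_add h10 (h7.trans h8)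
      _ ≤ _ := by nlinarith
  · have h1 := norm_sub_le (shiftedProduct a N k z) (expTaylor (scalePhase b k z))
    have h2 := norm_shiftedProduct_le a N k z
    have h3 := norm_expTaylor_le hθ1
    have h4 : 0 ≤ b ^ 3 := by positivity
    have h5 : (0 : ℝ) < (1 / 4) ^ k := by positivity
    push Not at hxz
    linarith

/-! ### Unboundedness -/

/-- The phase is b(e(w) + e(-w)) with w = λ_k x - y, so the Taylor polynomial has only the harmonics
0, ±1, ±2 in y; integrating against ψ samples ψ̂ at these points. -/
lemma expTaylor_scalePhase (b : ℝ) (k : ℕ) (x y : ℝ) :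
    expTaylor (scalePhase b k (x - (lac k)⁻¹ * y)) =
      (1 - b ^ 2) * unitExp (-(y * 0)) +
      b * Complex.I * unitExp (lac k * x) * unitExp (-(y * 1)) +
      b * Complex.I * unitExp (-(lac k * x)) * unitExp (-(y * (-1))) +
      (-(b ^ 2 / 2)) * unitExp (2 * (lac k * x)) * unitExp (-(y * 2)) +
      (-(b ^ 2 / 2)) * unitExp (-(2 * (lac k * x))) * unitExp (-(y * (-2))) := by
  have hk := (lac_pos k).ne'
  set w := lac k * x - y with hw
  have e0 : lac k * (x - (lac k)⁻¹ * y) = w := by rw [hw]; field_simp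
  have e1 : unitExp w = unitExp (lac k * x) * unitExp (-(y * 1)) := by
    rw [← unitExp_add]; congr 1; rw [hw]; ring
  have e2 : unitExp (-w) = unitExp (-(lac k * x)) * unitExp (-(y * (-1))) := by
    rw [← unitExp_add]; congr 1; rw [hw]; ring
  have e3 : unitExp w * unitExp w = unitExp (2 * (lac k * x)) * unitExp (-(y * 2)) := by
    rw [← unitExp_add, ← unitExp_add]; congr 1; rw [hw]; ring
  have e4 : unitExp (-w) * unitExp (-w) =
      unitExp (-(2 * (lac k * x))) * unitExp (-(y * (-2))) := by
    rw [← unitExp_add, ← unitExp_add]; congr 1; rw [hw]; ring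
  have e5 : unitExp w * unitExp (-w) = 1 := by
    rw [← unitExp_add, add_neg_cancel, unitExp_zero]
  have e6 : unitExp (-(y * 0)) = 1 := by simp [unitExp_zero]
  have hc : (scalePhase b k (x - (lac k)⁻¹ * y) : ℂ) = b * (unitExp w + unitExp (-w)) := by
    rw [scalePhase, e0, unitExp, unitExp]
    push_cast
    rw [Complex.cos]
    ring_nf
  rw [expTaylor, hc, e6]
  linear_combination b * Complex.I * e1 + b * Complex.I * e2 - b ^ 2 / 2 * e3 - b ^ 2 / 2 * e4 -
    b ^ 2 * e5

/-- Convolution with a profile of value `1` at `1` extracts the first harmonic. -/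
lemma integral_mul_expTaylor (ψ : 𝓢(ℝ, ℂ)) (hψ : IsProfile (𝓕 (ψ : ℝ → ℂ)))
    (h1 : 𝓕 (ψ : ℝ → ℂ) 1 = 1) (b : ℝ) (k : ℕ) (x : ℝ) :
    ∫ y, ψ y * expTaylor (scalePhase b k (x - (lac k)⁻¹ * y)) =
      b * Complex.I * unitExp (lac k * x) := by
  have hz (w : ℝ) (hw : w ∉ Set.Icc (1 / 2 : ℝ) (3 / 2)) :
      ∫ y, ψ y * unitExp (-(y * w)) = 0 := by
    rw [← fourier_eq_integral_unitExp, hψ.eq_zero w hw]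
  have hi (c : ℂ) (w : ℝ) : Integrable (fun y => c * (ψ y * unitExp (-(y * w)))) := by
    refine (ψ.integrable.mono (Continuous.aestronglyMeasurable ?_)
      (ae_of_all _ fun y => ?_)).const_mul c
    · have := ψ.continuous
      have := continuous_unitExp
      fun_prop
    · rw [norm_mul, norm_unitExp, mul_one]
  have e (y : ℝ) : ψ y * expTaylor (scalePhase b k (x - (lac k)⁻¹ * y)) =
      (1 - b ^ 2) * (ψ y * unitExp (-(y * 0))) +
      b * Complex.I * unitExp (lac k * x) * (ψ y * unitExp (-(y * 1))) +
      b * Complex.I * unitExp (-(lac k * x)) * (ψ y * unitExp (-(y * (-1)))) +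
      (-(b ^ 2 / 2)) * unitExp (2 * (lac k * x)) * (ψ y * unitExp (-(y * 2))) +
      (-(b ^ 2 / 2)) * unitExp (-(2 * (lac k * x))) * (ψ y * unitExp (-(y * (-2)))) := by
    rw [expTaylor_scalePhase]
    ring
  simp only [e]
  rw [integral_add, integral_add, integral_add, integral_add]
  · simp only [integral_const_mul]
    rw [hz 0 (by norm_num), hz (-1) (by norm_num), hz 2 (by norm_num), hz (-2) (by norm_num),
      ← fourier_eq_integral_unitExp, h1]
    ring
  · exact hi _ _
  · exact hi _ _
  · exact (hi _ _).add (hi _ _)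
  · exact hi _ _
  · exact ((hi _ _).add (hi _ _)).add (hi _ _)
  · exact hi _ _
  · exact (((hi _ _).add (hi _ _)).add (hi _ _)).add (hi _ _)
  · exact hi _ _

lemma norm_integral_shiftedProduct_sub_le (ψ : 𝓢(ℝ, ℂ)) (hψ : IsProfile (𝓕 (ψ : ℝ → ℂ)))
    (h1 : 𝓕 (ψ : ℝ → ℂ) 1 = 1) {a : ℝ} (ha0 : 0 ≤ a) (ha : a ≤ 1 / 2) (N k : ℕ) {x : ℝ}
    (hx : x ∈ Set.Icc (0 : ℝ) 1) :
    ‖(∫ y, ψ y * shiftedProduct a N k (x - (lac k)⁻¹ * y)) -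
        lacAmp a N k * Complex.I * unitExp (lac k * x)‖ ≤
      8 * (∫ y, ‖ψ y‖) * lacAmp a N k ^ 3 +
        8 * ((∫ y, ‖ψ y‖) + ∫ y, |y| * ‖ψ y‖) * (1 / 4) ^ k := by
  set b := lacAmp a N k with hb
  have hb0 : 0 ≤ b := lacAmp_nonneg ha0 N k
  have hb1 : b ≤ a := lacAmp_le ha0 N k
  have hl := lac_pos k
  have hψc := ψ.continuous
  have hiψ : Integrable (fun y => ‖ψ y‖) := ψ.integrable.norm
  have hiψ' : Integrable (fun y => |y| * ‖ψ y‖) := by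
    simpa using ψ.integrable_pow_mul volume 1
  have hcT : Continuous (fun z => expTaylor (scalePhase b k z)) := by
    unfold expTaylor scalePhase
    fun_prop
  have hiT : Integrable (fun y => ψ y * expTaylor (scalePhase b k (x - (lac k)⁻¹ * y))) := by
    refine (ψ.integrable.norm.const_mul 3).mono'
      (hψc.mul (hcT.comp (by fun_prop))).aestronglyMeasurable (ae_of_all _ fun y => ?_)
    rw [norm_mul, mul_comm]
    gcongr
    exact norm_expTaylor_le ((abs_scalePhase_le hb0 k _).trans (by linarith))
  have hiS : Integrable (fun y => ψ y * shiftedProduct a N k (x - (lac k)⁻¹ * y)) := by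
    have := continuous_shiftedProduct a N k
    refine ψ.integrable.norm.mono'
      (Continuous.aestronglyMeasurable (by fun_prop)) (ae_of_all _ fun y => ?_)
    rw [norm_mul]
    exact mul_le_of_le_one_right (norm_nonneg _) (norm_shiftedProduct_le _ _ _ _)
  rw [← integral_mul_expTaylor ψ hψ h1, ← integral_sub hiS hiT]
  -- Here z = x - r_k y, so the cutoff error 8|x - z| is at most 8·4^{-k}|y|, summable in k after
  -- pairing with the first moment of ψ.
  have hinv : (lac k)⁻¹ ≤ (1 / 4) ^ k := by
    rw [one_div, inv_pow]
    exact inv_anti₀ (by positivity) (four_pow_le_lac k)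
  have hbound (y : ℝ) : ‖ψ y * shiftedProduct a N k (x - (lac k)⁻¹ * y) -
      ψ y * expTaylor (scalePhase b k (x - (lac k)⁻¹ * y))‖ ≤
      (8 * b ^ 3 + 8 * (1 / 4) ^ k) * ‖ψ y‖ + 8 * (1 / 4) ^ k * (|y| * ‖ψ y‖) := by
    have h := norm_shiftedProduct_sub_le ha0 ha N k hx (x - (lac k)⁻¹ * y)
    rw [sub_sub_cancel, abs_mul, abs_of_pos (inv_pos.2 hl)] at h
    rw [← mul_sub, norm_mul]
    calc _ ≤ ‖ψ y‖ * (8 * b ^ 3 + 8 * (1 / 4) ^ k + 8 * ((1 / 4) ^ k * |y|)) := by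
          gcongr
          exact h.trans (by gcongr)
      _ = _ := by ring
  refine (norm_integral_le_of_norm_le ((hiψ.const_mul _).add (hiψ'.const_mul _))
    (ae_of_all _ hbound)).trans (le_of_eq ?_)
  simp only [Pi.add_apply]
  rw [integral_add (hiψ.const_mul _) (hiψ'.const_mul _), integral_const_mul, integral_const_mul]
  ring

/-- On `[0, 1]` the operator reproduces the lacunary sum up to a bounded error. -/
lemma exists_norm_bilinearMultiplier_sub_le (ψ : 𝓢(ℝ, ℂ)) (hψ : IsProfile (𝓕 (ψ : ℝ → ℂ)))
    (h1 : 𝓕 (ψ : ℝ → ℂ) 1 = 1) : ∃ B : ℝ, ∀ (a : ℝ) (N : ℕ), 0 ≤ a → a ≤ 1 / 2 → N * a ^ 3 ≤ 1 →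
      ∀ x ∈ Set.Icc (0 : ℝ) 1,
        ‖bilinearMultiplier (lacSymbol (𝓕 (ψ : ℝ → ℂ))) (modCutoff (contDiff_lacPhase a N))
          (modCutoff (contDiff_lacPhase a N).neg) x - a * Complex.I * lacSum N x‖ ≤ B := by
  set A₀ := ∫ y, ‖ψ y‖ with hA₀
  set A₁ := A₀ + ∫ y, |y| * ‖ψ y‖ with hA₁
  have hA₀' : 0 ≤ A₀ := integral_nonneg fun y => norm_nonneg _
  refine ⟨8 * A₀ + 8 * A₁ * (1 - 1 / 4)⁻¹, fun a N ha0 ha hN x hx => ?_⟩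
  rw [bilinearMultiplier_lacSymbol ψ hψ]
  set T : ℕ → ℂ := fun k => ∫ y, ψ y * shiftedProduct a N k (x - (lac k)⁻¹ * y) with hT
  set M : ℕ → ℂ := fun k => lacAmp a N k * Complex.I * unitExp (lac k * x) with hM
  have hMs : HasSum M (a * Complex.I * lacSum N x) := by
    have h : HasSum M (∑ k ∈ Finset.range N, M k) := hasSum_sum_of_ne_finset_zero fun k hk => by
      have : ¬ k < N := by simpa using hk
      simp [hM, lacAmp, this]
    convert h using 1
    rw [lacSum, Finset.mul_sum]
    refine Finset.sum_congr rfl fun k hk => ?_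
    simp [hM, lacAmp, Finset.mem_range.1 hk]
  have hbs : HasSum (fun k => 8 * A₀ * lacAmp a N k ^ 3 + 8 * A₁ * (1 / 4 : ℝ) ^ k)
      (8 * A₀ * (N * a ^ 3) + 8 * A₁ * (1 - 1 / 4)⁻¹) := by
    refine HasSum.add (HasSum.mul_left _ ?_)
      ((hasSum_geometric_of_lt_one (by norm_num) (by norm_num)).mul_left _)
    have h : HasSum (fun k => lacAmp a N k ^ 3) (∑ k ∈ Finset.range N, lacAmp a N k ^ 3) :=
      hasSum_sum_of_ne_finset_zero fun k hk => by
        have : ¬ k < N := by simpa using hk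
        simp [lacAmp, this]
    have e : ∑ k ∈ Finset.range N, lacAmp a N k ^ 3 = N * a ^ 3 := by
      rw [Finset.sum_congr rfl fun k hk => by
        rw [show lacAmp a N k = a from if_pos (Finset.mem_range.1 hk)]]
      simp
    rwa [e] at h
  have hle (k : ℕ) : ‖T k - M k‖ ≤ 8 * A₀ * lacAmp a N k ^ 3 + 8 * A₁ * (1 / 4 : ℝ) ^ k :=
    norm_integral_shiftedProduct_sub_le ψ hψ h1 ha0 ha N k hx
  have hds : Summable (fun k => T k - M k) := Summable.of_norm_bounded hbs.summable hle
  have hTs : Summable T := by simpa using hds.add hMs.summable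
  change ‖∑' k, T k - _‖ ≤ _
  rw [← hMs.tsum_eq, ← hTs.tsum_sub hMs.summable]
  refine (tsum_of_norm_bounded hbs hle).trans ?_
  have : 8 * A₀ * (N * a ^ 3) ≤ 8 * A₀ * 1 := by gcongr
  linarith

lemma exists_schwartz_profile : ∃ ψ : 𝓢(ℝ, ℂ), IsProfile (𝓕 (ψ : ℝ → ℂ)) ∧
    𝓕 (ψ : ℝ → ℂ) 1 = 1 := by
  let φ : ContDiffBump (1 : ℝ) := ⟨1 / 4, 1 / 2, by norm_num, by norm_num⟩
  let Φ : 𝓢(ℝ, ℂ) := HasCompactSupport.toSchwartzMap (f := fun y => (φ y : ℂ))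
    (φ.hasCompactSupport.comp_left (g := Complex.ofReal) Complex.ofReal_zero)
    (Complex.ofRealCLM.contDiff.comp φ.contDiff)
  have hΦ (y : ℝ) : Φ y = (φ y : ℂ) := rfl
  have h : 𝓕 (((𝓕⁻ Φ : 𝓢(ℝ, ℂ))) : ℝ → ℂ) = Φ := by
    rw [← SchwartzMap.fourier_coe, FourierTransform.fourier_fourierInv_eq]
  refine ⟨𝓕⁻ Φ, ?_, ?_⟩
  · rw [h]
    refine ⟨Φ.smooth _, fun w hw => ?_⟩
    have hd : φ.rOut ≤ dist w 1 := by
      by_contra hlt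
      push Not at hlt
      rw [Real.dist_eq] at hlt
      obtain ⟨h1, h2⟩ := abs_lt.1 hlt
      simp only [φ] at h1 h2
      exact hw ⟨by linarith, by linarith⟩
    rw [hΦ, φ.zero_of_le_dist hd, Complex.ofReal_zero]
  · rw [h, hΦ, φ.one_of_mem_closedBall (Metric.mem_closedBall_self φ.rIn_pos.le),
      Complex.ofReal_one]

/-- There is a symbol adapted to the line `ξ₁ + ξ₂ = 0` whose bilinear multiplier operator
satisfies no `L^p` estimates. -/
theorem mainTheorem3 :
    ∃ m : FreqPlane → ℂ, IsAdaptedToLine m ∧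
      ∀ p₁ p₂ p : ℝ≥0∞, 0 < p₁ → 0 < p₂ → p⁻¹ = p₁⁻¹ + p₂⁻¹ →
        ¬ SatisfiesLpEstimate (bilinearMultiplier m) p₁ p₂ p := by
  obtain ⟨ψ, hψ, h1⟩ := exists_schwartz_profile
  refine ⟨lacSymbol (𝓕 (ψ : ℝ → ℂ)), isAdaptedToLine_lacSymbol hψ, ?_⟩
  rintro p₁ p₂ p hp₁ hp₂ hp ⟨C, hC⟩
  obtain ⟨B, hB⟩ := exists_norm_bilinearMultiplier_sub_le ψ hψ h1
  have hp0 : p ≠ 0 := by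
    rw [← ENNReal.inv_ne_top, hp]
    exact ENNReal.add_ne_top.2 ⟨ENNReal.inv_ne_top.2 hp₁.ne', ENNReal.inv_ne_top.2 hp₂.ne'⟩
  set K : ℝ≥0∞ := C * eLpNorm (cutoff : ℝ → ℝ) p₁ volume * eLpNorm (cutoff : ℝ → ℝ) p₂ volume
    with hK
  have hKtop : K ≠ ⊤ := ENNReal.mul_ne_top
    (ENNReal.mul_ne_top ENNReal.coe_ne_top (eLpNorm_cutoff_lt_top p₁).ne)
    (eLpNorm_cutoff_lt_top p₂).ne
  -- For p = ∞ the exponent is 1/0 = 0 and δ = 1, as the supremum norm requires.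
  set δ : ℝ≥0∞ := (1 / 8 : ℝ≥0∞) ^ (1 / p.toReal) with hδ
  have hδ0 : δ ≠ 0 := (ENNReal.rpow_pos (by simp) (by simp)).ne'
  have hmain (n : ℕ) (hn : 2 ≤ n) : ENNReal.ofReal (√(n / 2) - B) * δ ≤ K := by
    have hn0 : (0 : ℝ) < n := by positivity
    have hn2 : (2 : ℝ) ≤ n := by exact_mod_cast hn
    -- With N = n³ the cubic error N a³ is exactly 1, while a√(N/2) = √(n/2) still grows.
    set a : ℝ := (n : ℝ)⁻¹ with ha
    have ha2 : a ≤ 1 / 2 := by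
      rw [ha, one_div]
      exact inv_anti₀ (by norm_num) hn2
    have hN : ((n ^ 3 : ℕ) : ℝ) * a ^ 3 ≤ 1 := by
      rw [ha]
      push_cast
      rw [← mul_pow, mul_inv_cancel₀ hn0.ne', one_pow]
    have hb := hB a (n ^ 3) (by positivity) ha2 hN
    have hest := hC (modCutoff (contDiff_lacPhase a (n ^ 3)))
      (modCutoff (contDiff_lacPhase a (n ^ 3)).neg)
    rw [eLpNorm_modCutoff, eLpNorm_modCutoff] at hest
    refine le_trans ?_ hest
    rcases le_or_gt (√(n / 2) - B) 0 with hneg | hpos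
    · rw [ENNReal.ofReal_of_nonpos hneg, zero_mul]
      exact zero_le
    have hvol : 1 / 8 ≤ volume (lacLarge (n ^ 3)) := volume_lacLarge (by positivity)
    have hvol0 : volume (lacLarge (n ^ 3)) ≠ 0 := (lt_of_lt_of_le (by simp) hvol).ne'
    have hcmp : eLpNorm ((lacLarge (n ^ 3)).indicator fun _ => √(n / 2) - B) p volume ≤
        eLpNorm (bilinearMultiplier (lacSymbol (𝓕 (ψ : ℝ → ℂ)))
          (modCutoff (contDiff_lacPhase a (n ^ 3)))
          (modCutoff (contDiff_lacPhase a (n ^ 3)).neg)) p volume := by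
      refine eLpNorm_mono fun x => ?_
      by_cases hx : x ∈ lacLarge (n ^ 3)
      · rw [Set.indicator_of_mem hx, Real.norm_of_nonneg hpos.le]
        have h2 := hb x ⟨hx.1.1.le, hx.1.2⟩
        have h3 := norm_sub_norm_le (a * Complex.I * lacSum (n ^ 3) x)
          (bilinearMultiplier (lacSymbol (𝓕 (ψ : ℝ → ℂ)))
          (modCutoff (contDiff_lacPhase a (n ^ 3)))
          (modCutoff (contDiff_lacPhase a (n ^ 3)).neg) x)
        rw [norm_sub_rev] at h3
        have h4 : √(n / 2) ≤ ‖(a : ℂ) * Complex.I * lacSum (n ^ 3) x‖ := by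
          refine Real.sqrt_le_iff.2 ⟨norm_nonneg _, ?_⟩
          rw [norm_mul, norm_mul, Complex.norm_I, mul_one, Complex.norm_real, mul_pow,
            Real.norm_eq_abs, sq_abs]
          have h5 := hx.2
          calc (n : ℝ) / 2 = a ^ 2 * (((n ^ 3 : ℕ) : ℝ) / 2) := by
                rw [ha]; push_cast; field_simp
            _ ≤ _ := by gcongr
        linarith
      · rw [Set.indicator_of_notMem hx, norm_zero]
        exact norm_nonneg _
    refine le_trans ?_ hcmp
    rw [eLpNorm_indicator_const' (measurableSet_lacLarge _) hvol0 hp0, Real.enorm_of_nonneg hpos.le]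
    exact mul_le_mul_right (ENNReal.rpow_le_rpow hvol (by positivity)) _
  have hlim : Tendsto (fun n : ℕ => √((n : ℝ) / 2) - B) atTop atTop :=
    tendsto_atTop_add_const_right _ (-B) (Real.tendsto_sqrt_atTop.comp
      (tendsto_natCast_atTop_atTop.atTop_div_const (by norm_num)))
  have hKδ : K / δ ≠ ⊤ := ENNReal.div_ne_top hKtop hδ0
  obtain ⟨n, hn2, hn⟩ := ((eventually_ge_atTop 2).and
    (hlim.eventually_gt_atTop (K / δ).toReal)).exists
  have h := (ENNReal.le_div_iff_mul_le (Or.inl hδ0) (Or.inr hKtop)).2 (hmain n hn2)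
  exact absurd ((ENNReal.ofReal_le_iff_le_toReal hKδ).1 h) (not_le.2 hn)
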